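/- Let $n\ge 1$ be an integer and let $q,x_1,\dots,x_n\in\mathbb C$ with $0<|q|<1$. Write $(z)_k=\prod_{i=0}^{k-1}(1-zq^i)$ for integers $k\ge0$, $(z)_\infty=\prod_{i=0}^{\infty}(1-zq^i)$, and $|\boldsymbol k|=k_1+\cdots+k_n$ for $\boldsymbol k=(k_1,\dots,k_n)\in\mathbb Z_{\ge0}^n$. For $\alpha\in\mathbb C$ put \[ \begin{aligned} S_\alpha(\boldsymbol k)={}&\prod_{1\le r<s\le n}\frac{1-q^{k_r-k_s}x_r/x_s}{1-x_r/x_s}\;\prod_{r,s=1}^{n}\bigl(qx_r/x_s\bigr)_{k_r}^{-1}\\ &\times\prod_{r=1}^{n}\bigl\{(1-\alpha x_rq^{k_r+|\boldsymbol k|})(\alpha x_r)_{|\boldsymbol k|}\bigr\}\;\prod_{r=1}^{n}x_r^{(n+1)k_r-|\boldsymbol k|}\\ &\times(-1)^{n|\boldsymbol k|}\,\alpha^{|\boldsymbol k|}\,q^{(n+1)\sum_{r=1}^{n}\binom{k_r}{2}+\binom{|\boldsymbol k|}{2}+\sum_{r=1}^{n}rk_r}. \end{aligned} \] Suppose that none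 of the denominators in $S_\alpha(\boldsymbol k)$ vanishes, that is, $x_r\ne0$ for all $r$, $x_r\neq x_s$ for $r<s$, and $(qx_r/x_s)_k\ne0$ for all $r,s$ and all $k\ge0$. (i) ($A_n$ extension of Sylvester's identity.) For every $\alpha\in\mathbb C$ with $(\alpha x_r)_\infty\neq0$ for $r=1,\dots,n$, the series $\sum_{\boldsymbol k\in\mathbb Z_{\ge0}^n}S_\alpha(\boldsymbol k)$ converges absolutely and \[ 1=\frac{1}{\prod_{r=1}^{n}(\alpha x_r)_\infty}\sum_{k_1,\dots,k_n\ge0}S_\alpha(\boldsymbol k). \] (ii) ($A_n$ extension of Euler's pentagonal number theorem, the case $\alpha=1$.) If $x_r\ne1$ for $r=1,\dots,n$, then $\sum_{\boldsymbol k}S_1(\boldsymbol k)$ converges absolutely and \[ \prod_{r=1}^{n}(qx_r)_\infty=\frac{1}{\prod_{r=1}^{n}(1-x_r)}\sum_{k_1,\dots,k_n\ge0}S_1(\boldsymbol k). \] -/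

import Mathlib

open scoped BigOperators

noncomputable section

namespace AnSylvester

/-- The finite `q`-shifted factorial `(z)_k = (1 - z)(1 - z q) ⋯ (1 - z q^(k-1))`. -/
def qPoch (q z : ℂ) (k : ℕ) : ℂ :=
  ∏ i ∈ Finset.range k, (1 - z * q ^ i)

/-- The infinite `q`-shifted factorial `(z)_∞ = ∏_{i ≥ 0} (1 - z q^i)`. -/
def qPochInf (q z : ℂ) : ℂ :=
  ∏' i : ℕ, (1 - z * q ^ i)

/-- For `|q| < 1` the product defining `(z)_∞` converges. -/
theorem multipliable_qPochInf {q : ℂ} (hq : ‖q‖ < 1) (z : ℂ) :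
    Multipliable fun i : ℕ => 1 - z * q ^ i := by
  have h : Summable fun i : ℕ => ‖-(z * q ^ i)‖ := by
    simp only [norm_neg, norm_mul, norm_pow]
    exact (summable_geometric_of_lt_one (norm_nonneg q) hq).mul_left ‖z‖
  simpa [sub_eq_add_neg] using multipliable_one_add_of_summable h

/-- For `|q| < 1` the two factorials satisfy `(z)_k (z q^k)_∞ = (z)_∞`. -/
theorem qPoch_mul_qPochInf {q : ℂ} (hq : ‖q‖ < 1) (z : ℂ) (k : ℕ) :
    qPoch q z k * qPochInf q (z * q ^ k) = qPochInf q z := by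
  have h : (fun i : ℕ => 1 - z * q ^ k * q ^ i) = fun i : ℕ => 1 - z * q ^ (i + k) := by
    funext i; ring
  have hm := multipliable_qPochInf hq (z * q ^ k)
  unfold qPoch qPochInf
  rw [h] at hm ⊢
  exact Multipliable.prod_mul_tprod_nat_mul' (f := fun i : ℕ => 1 - z * q ^ i) hm

/-- The weight `|k| = k_1 + ⋯ + k_n` of a multi-index. -/
def weight {n : ℕ} (k : Fin n → ℕ) : ℕ := ∑ r, k r

/-- The summand of the `A_n` series at the multi-index `k`. The index `r : Fin n` stands for
the `(r + 1)`-st variable, so `∑ r k_r` reads `∑ r, (r + 1) * k r`. -/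
def term {n : ℕ} (q : ℂ) (x : Fin n → ℂ) (α : ℂ) (k : Fin n → ℕ) : ℂ :=
  (∏ r, ∏ s ∈ Finset.Ioi r,
      (1 - q ^ ((k r : ℤ) - (k s : ℤ)) * (x r / x s)) / (1 - x r / x s))
    * (∏ r, ∏ s, (qPoch q (q * x r / x s) (k r))⁻¹)
    * (∏ r, (1 - α * x r * q ^ (k r + weight k)) * qPoch q (α * x r) (weight k))
    * (∏ r, x r ^ (((n : ℤ) + 1) * (k r : ℤ) - (weight k : ℤ)))
    * (-1) ^ (n * weight k) * α ^ weight k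
    * q ^ ((n + 1) * (∑ r, (k r).choose 2) + (weight k).choose 2
        + ∑ r : Fin n, ((r : ℕ) + 1) * k r)

end AnSylvester

end

/-! Fix `x` and let F(α) be the sum of the series. Everything rests on the functional equation F(α)
= ∏_r (1 - α x_r) · F(αq). Iterating it gives F(α) = ∏_r (α x_r)_m · F(α q^m); as m → ∞, dominated
convergence sends F(α q^m) to F(0) = 1, so F(α) = ∏_r (α x_r)_∞.

For n = 1 the functional equation comes from 1 - αx q^(2k) = q^k (1 - αx q^k) + (1 - q^k): the last
piece vanishes at k = 0, so it can be shifted by one in k and regrouped with the first. For general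
n, put y_r = x_r q^(k_r). The splitting becomes the partial fraction expansion
`prod_sub_mul_prod_eq_sum`: a base part, in which (α x_r)_|k| is completed to (α x_r)_(|k|+1), and
for each i a piece that vanishes at k_i = 0. After k_i ↦ k_i + 1 the i-th piece is the base part
times a Lagrange term (`nodePart_add_single`), and a second expansion, `prod_sub_one_eq_sum`, adds
these up to the summand at αq.

For convergence, one factor q^(∑ binom(k_r, 2)) beats every geometric growth, while all other
factors together are at most C · D^|k|, uniformly for bounded α. -/

noncomputable section

namespace AnSylvester

/-! ### Lagrange interpolation at reciprocal nodes -/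

/-- Lagrange interpolation at the nodes `1 / y i`. -/
theorem eval_eq_sum_reciprocal_nodes {ι F : Type*} [Fintype ι] [DecidableEq ι] [Field F]
    {y : ι → F} (hy : Function.Injective y) (hy0 : ∀ i, y i ≠ 0) {P : Polynomial F}
    (hP : P.degree < Fintype.card ι) (A : F) :
    P.eval A = ∑ i, P.eval (y i)⁻¹ *
      ∏ j ∈ Finset.univ.erase i, (1 - A * y j) / (1 - y j / y i) := by
  have hinj : Set.InjOn (fun i => (y i)⁻¹) (Finset.univ : Finset ι) :=
    fun i _ j _ h => hy (inv_injective h)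
  conv_lhs => rw [Lagrange.eq_interpolate hinj (f := P) (by simpa using hP)]
  rw [Lagrange.interpolate_apply, Polynomial.eval_finsetSum]
  refine Finset.sum_congr rfl fun i _ => ?_
  rw [Polynomial.eval_mul, Polynomial.eval_C, Lagrange.basis, Polynomial.eval_prod]
  congr 1
  refine Finset.prod_congr rfl fun j hj => ?_
  have hij : y i ≠ y j := fun h => (Finset.ne_of_mem_erase hj) (hy h).symm
  have h1 : y i - y j ≠ 0 := sub_ne_zero.2 hij
  have h2 : y j - y i ≠ 0 := sub_ne_zero.2 hij.symm
  have hi := hy0 i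
  have hj' := hy0 j
  have h3 : (y i)⁻¹ - (y j)⁻¹ ≠ 0 := sub_ne_zero.2 fun h => hij (inv_injective h)
  have h4 : 1 - y j / y i ≠ 0 := by
    rw [one_sub_div hi]; exact div_ne_zero h1 hi
  simp only [Lagrange.basisDivisor, Polynomial.eval_mul, Polynomial.eval_C, Polynomial.eval_sub,
    Polynomial.eval_X]
  rw [inv_mul_eq_div, div_eq_div_iff h3 h4]
  field_simp
  ring

open Polynomial in
theorem natDegree_prod_one_sub_le {ι F : Type*} [Fintype ι] [Field F] (y : ι → F) :
    (∏ i, (1 - X * C (y i))).natDegree ≤ Fintype.card ι := by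
  refine (natDegree_prod_le _ _).trans ?_
  refine (Finset.sum_le_card_nsmul _ _ 1 fun i _ => ?_).trans (by simp)
  compute_degree

open Polynomial in
theorem coeff_card_prod_one_sub {ι F : Type*} [Fintype ι] [Field F] (y : ι → F) :
    (∏ i, (1 - X * C (y i))).coeff (Fintype.card ι) = ∏ i, (-y i) := by
  have h := coeff_prod_of_natDegree_le (s := (Finset.univ : Finset ι))
    (f := fun i => (1 - X * C (y i) : F[X])) 1 (fun i _ => by compute_degree)
  rw [mul_one] at h
  rw [← Finset.card_univ, h]
  exact Finset.prod_congr rfl fun i _ => by simp [coeff_one]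

open Polynomial in
/-- Partial fractions for the difference of two products with proportional leading terms. -/
theorem prod_sub_mul_prod_eq_sum {ι F : Type*} [Fintype ι] [DecidableEq ι] [Field F]
    {y : ι → F} (hy : Function.Injective y) (hy0 : ∀ i, y i ≠ 0) (x : ι → F) (c : F)
    (hc : ∏ i, y i = c * ∏ i, x i) (A : F) :
    ∏ i, (1 - A * y i) - c * ∏ i, (1 - A * x i) =
      ∑ i, -(c * ∏ r, (1 - x r / y i)) *
        ∏ j ∈ Finset.univ.erase i, (1 - A * y j) / (1 - y j / y i) := by
  set P : F[X] := ∏ i, (1 - X * C (y i)) - C c * ∏ i, (1 - X * C (x i)) with hPdef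
  have hev (a : F) : P.eval a = ∏ i, (1 - a * y i) - c * ∏ i, (1 - a * x i) := by
    simp [hPdef, eval_prod, mul_comm a]
  have hle : P.natDegree ≤ Fintype.card ι :=
    (natDegree_sub_le _ _).trans (max_le (natDegree_prod_one_sub_le y)
      ((natDegree_C_mul_le _ _).trans (natDegree_prod_one_sub_le x)))
  -- By `hc` the two leading coefficients cancel, which brings the degree below the number of nodes.
  have htop : P.coeff (Fintype.card ι) = 0 := by
    simp only [hPdef, coeff_sub, coeff_C_mul, coeff_card_prod_one_sub, Finset.prod_neg, hc]
    ring
  have hdeg : P.degree < Fintype.card ι := by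
    refine lt_of_le_of_ne (natDegree_le_iff_degree_le.1 hle) fun h => ?_
    exact coeff_ne_zero_of_eq_degree h htop
  rw [← hev, eval_eq_sum_reciprocal_nodes hy hy0 hdeg A]
  refine Finset.sum_congr rfl fun i _ => ?_
  congr 1
  have h0 : ∏ r, (1 - (y i)⁻¹ * y r) = 0 :=
    Finset.prod_eq_zero (Finset.mem_univ i) (by simp [hy0 i])
  rw [hev, h0, zero_sub]
  congr 2
  exact Finset.prod_congr rfl fun r _ => by rw [div_eq_inv_mul]

-- The left side can have degree equal to the number of nodes, one too many for interpolation. It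
-- vanishes at 0, so its quotient by `X` is interpolated instead; at `(y i)⁻¹` that quotient is `-y
-- i`.
open Polynomial in
theorem prod_sub_one_eq_sum {ι F : Type*} [Fintype ι] [DecidableEq ι] [Field F]
    {y : ι → F} (hy : Function.Injective y) (hy0 : ∀ i, y i ≠ 0) (B : F) :
    ∏ i, (1 - B * y i) - 1 =
      ∑ i, -(B * y i) * ∏ j ∈ Finset.univ.erase i, (1 - B * y j) / (1 - y j / y i) := by
  set P : F[X] := ∏ i, (1 - X * C (y i)) - 1 with hPdef
  have hev (a : F) : P.eval a = ∏ i, (1 - a * y i) - 1 := by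
    simp [hPdef, eval_prod, mul_comm a]
  obtain ⟨Q, hQ⟩ : X ∣ P := by
    rw [X_dvd_iff, coeff_zero_eq_eval_zero, hev]; simp
  have hle : P.natDegree ≤ Fintype.card ι :=
    (natDegree_sub_le _ _).trans (max_le (natDegree_prod_one_sub_le y) (by simp))
  have hdeg : Q.degree < Fintype.card ι := by
    by_cases hQ0 : Q = 0
    · simp [hQ0]
    · rw [hQ, natDegree_X_mul hQ0] at hle
      rw [degree_eq_natDegree hQ0]
      exact_mod_cast hle
  rw [← hev, hQ, eval_mul, eval_X, eval_eq_sum_reciprocal_nodes hy hy0 hdeg B, Finset.mul_sum]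
  refine Finset.sum_congr rfl fun i _ => ?_
  have h0 : ∏ r, (1 - (y i)⁻¹ * y r) = 0 :=
    Finset.prod_eq_zero (Finset.mem_univ i) (by simp [hy0 i])
  have h1 : Q.eval (y i)⁻¹ = -y i := by
    have := hev (y i)⁻¹
    rw [h0, hQ, eval_mul, eval_X] at this
    have hi := mul_inv_cancel₀ (hy0 i)
    linear_combination y i * this - Q.eval (y i)⁻¹ * hi
  rw [h1]
  ring

end AnSylvester

end

noncomputable section

namespace AnSylvester

variable {n : ℕ}

/-! ### The summand and its shifts -/

/-- The shifted variable `x_r q^(k_r)`. -/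
def node (q : ℂ) (x : Fin n → ℂ) (k : Fin n → ℕ) (r : Fin n) : ℂ := x r * q ^ k r

/-- The part of the summand that does not depend on `α`. -/
def coef (q : ℂ) (x : Fin n → ℂ) (k : Fin n → ℕ) : ℂ :=
  (∏ r, ∏ s ∈ Finset.Ioi r, (node q x k s - node q x k r) / (x s - x r))
    * (∏ r, ∏ s, (qPoch q (q * x r / x s) (k r))⁻¹)
    * (∏ r, x r ^ (((n : ℤ) + 1) * (k r : ℤ) - (weight k : ℤ)))
    * (-1) ^ (n * weight k)
    * q ^ ((n + 1) * (∑ r, (k r).choose 2) + (weight k).choose 2 + weight k)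

theorem qPoch_succ (q z : ℂ) (k : ℕ) : qPoch q z (k + 1) = qPoch q z k * (1 - z * q ^ k) :=
  Finset.prod_range_succ _ _

theorem weight_add_single (k : Fin n → ℕ) (i : Fin n) :
    weight (k + Pi.single i 1) = weight k + 1 := by
  simp [weight, Finset.sum_add_distrib]

theorem node_ne_zero {q : ℂ} (hq : q ≠ 0) {x : Fin n → ℂ} (hx : ∀ r, x r ≠ 0)
    (k : Fin n → ℕ) (r : Fin n) : node q x k r ≠ 0 :=
  mul_ne_zero (hx r) (pow_ne_zero _ hq)

theorem prod_node (q : ℂ) (x : Fin n → ℂ) (k : Fin n → ℕ) :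
    ∏ r, node q x k r = q ^ weight k * ∏ r, x r := by
  simp only [node, Finset.prod_mul_distrib, Finset.prod_pow_eq_pow_sum, weight]
  ring

theorem node_injective {q : ℂ} (hq : q ≠ 0) {x : Fin n → ℂ}
    (hgen : ∀ r s (m : ℕ), r ≠ s → x s ≠ x r * q ^ m) (k : Fin n → ℕ) :
    Function.Injective (node q x k) := by
  -- Cancelling the smaller power of `q` reduces a coincidence of nodes to one excluded by `hgen`.
  have key : ∀ r s, k s ≤ k r → r ≠ s → node q x k s ≠ node q x k r := by
    intro r s hle hrs h
    obtain ⟨m, hm⟩ := Nat.exists_eq_add_of_le hle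
    refine hgen r s m hrs (mul_right_cancel₀ (pow_ne_zero (k s) hq) ?_)
    simp only [node, hm] at h
    rw [h]; ring
  intro r s h
  by_contra hrs
  rcases le_total (k s) (k r) with hle | hle
  · exact key r s hle hrs h.symm
  · exact key s r hle (Ne.symm hrs) h

theorem node_add_single_self (q : ℂ) (x : Fin n → ℂ) (k : Fin n → ℕ) (i : Fin n) :
    node q x (k + Pi.single i 1) i = q * node q x k i := by
  simp [node, pow_succ]; ring

theorem node_add_single_of_ne (q : ℂ) (x : Fin n → ℂ) (k : Fin n → ℕ) {i j : Fin n}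
    (h : j ≠ i) : node q x (k + Pi.single i 1) j = node q x k j := by
  simp [node, Pi.single_eq_of_ne h]

/-- With indices counted from 0, exactly `s` indices lie below `s`, so `q ^ k s` occurs `s` times.
-/
theorem prod_Ioi_pow_inv (q : ℂ) (k : Fin n → ℕ) :
    ∏ r : Fin n, ∏ s ∈ Finset.Ioi r, (q ^ k s)⁻¹ = (q ^ ∑ r : Fin n, (r : ℕ) * k r)⁻¹ := by
  rw [Finset.prod_comm' (t' := Finset.univ) (s' := fun s => Finset.Iio s) (by simp)]
  simp only [Finset.prod_const, Fin.card_Iio, ← Finset.prod_pow_eq_pow_sum, ← Finset.prod_inv_distrib]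
  exact Finset.prod_congr rfl fun r _ => by rw [inv_pow, ← pow_mul, mul_comm]

/-- Writing the first product as a quotient of Vandermonde products in the nodes and in `x` absorbs
`q ^ ∑ r * k r`; since the summand carries `r + 1`, a factor `q ^ weight k` is left over. The
dependence on `α` is thereby isolated. -/
theorem term_eq {q : ℂ} (hq : q ≠ 0) {x : Fin n → ℂ} (hx : ∀ r, x r ≠ 0)
    (hgen : ∀ r s (m : ℕ), r ≠ s → x s ≠ x r * q ^ m) (α : ℂ) (k : Fin n → ℕ) :
    term q x α k = coef q x k * (∏ r, (1 - α * q ^ weight k * node q x k r))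
      * (∏ r, qPoch q (α * x r) (weight k)) * α ^ weight k := by
  have hV : (∏ r, ∏ s ∈ Finset.Ioi r,
      (1 - q ^ ((k r : ℤ) - (k s : ℤ)) * (x r / x s)) / (1 - x r / x s)) =
      (∏ r, ∏ s ∈ Finset.Ioi r, (node q x k s - node q x k r) / (x s - x r)) *
        (q ^ ∑ r : Fin n, (r : ℕ) * k r)⁻¹ := by
    rw [← prod_Ioi_pow_inv, ← Finset.prod_mul_distrib]
    refine Finset.prod_congr rfl fun r _ => ?_
    rw [← Finset.prod_mul_distrib]
    refine Finset.prod_congr rfl fun s hs => ?_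
    have hrs : r ≠ s := (Finset.mem_Ioi.1 hs).ne
    have h1 : x s - x r ≠ 0 := sub_ne_zero.2 (by simpa using hgen r s 0 hrs)
    have h2 : 1 - x r / x s ≠ 0 := by
      rw [one_sub_div (hx s)]; exact div_ne_zero h1 (hx s)
    have h3 := hx s
    have h4 : q ^ k s ≠ 0 := pow_ne_zero _ hq
    rw [zpow_sub₀ hq, zpow_natCast, zpow_natCast]
    simp only [node]
    field_simp
  have hA : (∏ r, (1 - α * x r * q ^ (k r + weight k)) * qPoch q (α * x r) (weight k)) =
      (∏ r, (1 - α * q ^ weight k * node q x k r)) * ∏ r, qPoch q (α * x r) (weight k) := by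
    rw [← Finset.prod_mul_distrib]
    refine Finset.prod_congr rfl fun r _ => ?_
    rw [node]; ring
  have hS : ∑ r : Fin n, ((r : ℕ) + 1) * k r = (∑ r : Fin n, (r : ℕ) * k r) + weight k := by
    simp only [add_mul, one_mul, Finset.sum_add_distrib, weight]
  have h0 : q ^ (∑ r : Fin n, (r : ℕ) * k r) ≠ 0 := pow_ne_zero _ hq
  rw [term, coef, hV, hA, hS]
  simp only [pow_add]
  field_simp

/-- A product over pairs, equal to `1` off the pairs containing `i`. -/
theorem prod_Ioi_eq_prod_erase {M : Type*} [CommMonoid M] (d : Fin n → Fin n → M)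
    (hsymm : ∀ r s, d r s = d s r) (i : Fin n) (hd : ∀ r s, r ≠ i → s ≠ i → d r s = 1) :
    ∏ r, ∏ s ∈ Finset.Ioi r, d r s = ∏ j ∈ Finset.univ.erase i, d i j := by
  have h1 : ∀ r ∈ Finset.univ.erase i,
      ∏ s ∈ Finset.Ioi r, d r s = if r < i then d i r else 1 := by
    intro r hr
    have hri := Finset.ne_of_mem_erase hr
    split_ifs with h
    · rw [hsymm i r]
      exact Finset.prod_eq_single_of_mem i (Finset.mem_Ioi.2 h) fun s _ hs => hd r s hri hs
    · exact Finset.prod_eq_one fun s hs =>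
        hd r s hri fun e => h (e ▸ Finset.mem_Ioi.1 hs)
  have h2 : ∏ s ∈ Finset.Ioi i, d i s =
      ∏ s ∈ Finset.univ.erase i, if i < s then d i s else 1 := by
    rw [← Finset.prod_filter]
    refine Finset.prod_congr ?_ fun _ _ => rfl
    ext s
    simp only [Finset.mem_Ioi, Finset.mem_filter, Finset.mem_erase, Finset.mem_univ, and_true]
    exact ⟨fun h => ⟨h.ne', h⟩, fun h => h.2⟩
  rw [← Finset.mul_prod_erase _ _ (Finset.mem_univ i), Finset.prod_congr rfl h1, h2,
    ← Finset.prod_mul_distrib]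
  refine Finset.prod_congr rfl fun j hj => ?_
  rcases lt_or_gt_of_ne (Finset.ne_of_mem_erase hj) with h | h
  · simp [h, h.not_gt]
  · simp [h, h.not_gt]

theorem coef_add_single {q : ℂ} (hq : q ≠ 0) {x : Fin n → ℂ} (hx : ∀ r, x r ≠ 0)
    (hgen : ∀ r s (m : ℕ), r ≠ s → x s ≠ x r * q ^ m) (k : Fin n → ℕ) (i : Fin n) :
    coef q x (k + Pi.single i 1) = coef q x k *
      ((∏ j ∈ Finset.univ.erase i,
          (q * node q x k i - node q x k j) / (node q x k i - node q x k j))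
        * (∏ s, (1 - q * node q x k i / x s)⁻¹)
        * (node q x k i ^ (n + 1) / ∏ r, x r) * (-1) ^ n * q ^ (weight k + 1)) := by
  set k' := k + Pi.single i 1 with hk'
  have hw : weight k' = weight k + 1 := weight_add_single k i
  have hki : k' i = k i + 1 := by simp [hk']
  have hkj : ∀ j, j ≠ i → k' j = k j := fun j hj => by simp [hk', Pi.single_eq_of_ne hj]
  have hinj := node_injective hq hgen k
  have hV : (∏ r, ∏ s ∈ Finset.Ioi r, (node q x k' s - node q x k' r) / (x s - x r)) =
      (∏ r, ∏ s ∈ Finset.Ioi r, (node q x k s - node q x k r) / (x s - x r)) *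
      ∏ j ∈ Finset.univ.erase i,
          (q * node q x k i - node q x k j) / (node q x k i - node q x k j) := by
    -- The ratio of new to old differences is symmetric, as numerator and denominator both change
    -- sign, and is 1 on pairs avoiding `i`. The value 1 on the diagonal is a convention.
    have h := prod_Ioi_eq_prod_erase (fun r s => if r = s then 1 else
        (node q x k' s - node q x k' r) / (node q x k s - node q x k r)) (by
          intro r s
          by_cases hrs : r = s
          · simp [hrs]
          · simp only [hrs, Ne.symm hrs, if_false]
            rw [← neg_sub, ← neg_sub (node q x k r), neg_div_neg_eq]) i (by
          intro r s hr hs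
          by_cases hrs : r = s
          · simp [hrs]
          · simp only [hrs, if_false, hk', node_add_single_of_ne q x k hr,
              node_add_single_of_ne q x k hs]
            exact div_self (sub_ne_zero.2 fun e => hrs (hinj e).symm))
    have h' : ∏ j ∈ Finset.univ.erase i,
          (q * node q x k i - node q x k j) / (node q x k i - node q x k j) =
        ∏ j ∈ Finset.univ.erase i, (if i = j then 1 else
        (node q x k' j - node q x k' i) / (node q x k j - node q x k i)) := by
      refine Finset.prod_congr rfl fun j hj => ?_
      have hji := Finset.ne_of_mem_erase hj
      rw [if_neg hji.symm, hk', node_add_single_self, node_add_single_of_ne q x k hji,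
        ← neg_sub, ← neg_sub (node q x k j), neg_div_neg_eq]
    rw [h', ← h, ← Finset.prod_mul_distrib]
    refine Finset.prod_congr rfl fun r _ => ?_
    rw [← Finset.prod_mul_distrib]
    refine Finset.prod_congr rfl fun s hs => ?_
    have hrs : r ≠ s := (Finset.mem_Ioi.1 hs).ne
    have h1 : node q x k s - node q x k r ≠ 0 := sub_ne_zero.2 fun e => hrs (hinj e).symm
    rw [if_neg hrs]
    field_simp
  have hP : (∏ r, ∏ s, (qPoch q (q * x r / x s) (k' r))⁻¹) =
      (∏ r, ∏ s, (qPoch q (q * x r / x s) (k r))⁻¹) *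
        ∏ s, (1 - q * node q x k i / x s)⁻¹ := by
    rw [← Finset.mul_prod_erase _ _ (Finset.mem_univ i),
      ← Finset.mul_prod_erase _ (fun r => ∏ s, (qPoch q (q * x r / x s) (k r))⁻¹)
        (Finset.mem_univ i), mul_right_comm, ← Finset.prod_mul_distrib]
    congr 1
    · refine Finset.prod_congr rfl fun s _ => ?_
      rw [hki, qPoch_succ, mul_inv, node]
      congr 3
      ring
    · exact Finset.prod_congr rfl fun r hr => by rw [hkj r (Finset.ne_of_mem_erase hr)]
  have hX : (∏ r, x r ^ (((n : ℤ) + 1) * (k' r : ℤ) - (weight k' : ℤ))) =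
      (∏ r, x r ^ (((n : ℤ) + 1) * (k r : ℤ) - (weight k : ℤ))) *
        (x i ^ (n + 1) / ∏ r, x r) := by
    have : ∀ r, x r ^ (((n : ℤ) + 1) * (k' r : ℤ) - (weight k' : ℤ)) =
        x r ^ (((n : ℤ) + 1) * (k r : ℤ) - (weight k : ℤ)) *
          ((if r = i then x i ^ (n + 1) else 1) / x r) := by
      intro r
      by_cases hr : r = i
      · subst hr
        rw [if_pos rfl, hki, hw, ← zpow_natCast, div_eq_mul_inv, ← zpow_sub_one₀ (hx r),
          ← zpow_add₀ (hx r)]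
        congr 1; push_cast; ring
      · rw [if_neg hr, hkj r hr, hw, one_div, ← zpow_neg_one, ← zpow_add₀ (hx r)]
        congr 1; push_cast; ring
    simp only [this, Finset.prod_mul_distrib, Finset.prod_div_distrib]
    simp
  have hC : ∑ r, (k' r).choose 2 = (∑ r, (k r).choose 2) + k i := by
    rw [← Finset.add_sum_erase _ _ (Finset.mem_univ i),
      ← Finset.add_sum_erase _ (fun r => (k r).choose 2) (Finset.mem_univ i), hki,
      Finset.sum_congr rfl fun r hr => by rw [hkj r (Finset.ne_of_mem_erase hr)],
      Nat.choose_succ_succ' (k i) 1, Nat.choose_one_right]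
    ring
  have hE : (n + 1) * (∑ r, (k' r).choose 2) + (weight k').choose 2 + weight k' =
      ((n + 1) * (∑ r, (k r).choose 2) + (weight k).choose 2 + weight k)
        + (k i * (n + 1) + (weight k + 1)) := by
    rw [hC, hw, Nat.choose_succ_succ' (weight k) 1, Nat.choose_one_right]
    ring
  have hN : node q x k i ^ (n + 1) = x i ^ (n + 1) * q ^ (k i * (n + 1)) := by
    rw [node, mul_pow, ← pow_mul]
  rw [coef, coef, hV, hP, hX, hE, hw, hN, mul_add n, mul_one, pow_add (-1 : ℂ),
    pow_add q _ (k i * (n + 1) + _), pow_add q (k i * (n + 1))]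
  ring

/-! ### Splitting the summand and regrouping after a shift -/

/-- The part of the summand which survives at `k_i = 0` for all `i`. -/
def basePart (q : ℂ) (x : Fin n → ℂ) (α : ℂ) (k : Fin n → ℕ) : ℂ :=
  coef q x k * (∏ r, qPoch q (α * x r) (weight k + 1)) * (α * q) ^ weight k

/-- The part of the summand attached to the node `i`. -/
def nodePart (q : ℂ) (x : Fin n → ℂ) (α : ℂ) (i : Fin n) (k : Fin n → ℕ) : ℂ :=
  coef q x k * (∏ r, qPoch q (α * x r) (weight k)) * α ^ weight k *
    (-(q ^ weight k * ∏ r, (1 - x r / node q x k i)) *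
      ∏ j ∈ Finset.univ.erase i,
        (1 - α * q ^ weight k * node q x k j) / (1 - node q x k j / node q x k i))

/-- Partial fractions at the nodes with c = q^|k| and A = α q^|k|; the condition on c holds because
∏ y_r = q^|k| ∏ x_r. -/
theorem term_eq_add_sum {q : ℂ} (hq : q ≠ 0) {x : Fin n → ℂ} (hx : ∀ r, x r ≠ 0)
    (hgen : ∀ r s (m : ℕ), r ≠ s → x s ≠ x r * q ^ m) (α : ℂ) (k : Fin n → ℕ) :
    term q x α k = basePart q x α k + ∑ i, nodePart q x α i k := by
  have h := prod_sub_mul_prod_eq_sum (node_injective hq hgen k) (node_ne_zero hq hx k) x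
    (q ^ weight k) (prod_node q x k) (α * q ^ weight k)
  simp only [nodePart, basePart]
  rw [← Finset.mul_sum, ← h, term_eq hq hx hgen]
  simp only [qPoch_succ, Finset.prod_mul_distrib, mul_pow, mul_right_comm α _ (q ^ weight k)]
  ring

theorem nodePart_eq_zero {q : ℂ} {x : Fin n → ℂ} (hx : ∀ r, x r ≠ 0) (α : ℂ) (i : Fin n)
    (k : Fin n → ℕ) (hk : k i = 0) : nodePart q x α i k = 0 := by
  have : ∏ r, (1 - x r / node q x k i) = 0 :=
    Finset.prod_eq_zero (Finset.mem_univ i) (by simp [node, hk, hx i])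
  simp [nodePart, this]

/-- The new denominators 1 - q y_i / x_s cancel against the numerators 1 - x_s / (q y_i) up to
monomials, and the change in the Vandermonde product turns the Lagrange denominators at q y_i back
into those at y_i. -/
theorem nodePart_add_single {q : ℂ} (hq : q ≠ 0) {x : Fin n → ℂ} (hx : ∀ r, x r ≠ 0)
    (hgen : ∀ r s (m : ℕ), r ≠ s → x s ≠ x r * q ^ m)
    (hgen' : ∀ r s (m : ℕ), x s ≠ x r * q ^ (m + 1)) (α : ℂ) (i : Fin n) (k : Fin n → ℕ) :
    nodePart q x α i (k + Pi.single i 1) = basePart q x α k *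
      (-(α * q ^ (weight k + 1) * node q x k i) * ∏ j ∈ Finset.univ.erase i,
        (1 - α * q ^ (weight k + 1) * node q x k j) / (1 - node q x k j / node q x k i)) := by
  have hy0 := node_ne_zero hq hx k i
  have hinj := node_injective hq hgen k
  have hprodx : ∏ r, x r ≠ 0 := Finset.prod_ne_zero_iff.2 fun r _ => hx r
  have hsx : ∀ s, x s ≠ q * node q x k i := fun s h => hgen' i s (k i) (by rw [h, node]; ring)
  have h1 : (∏ s, (1 - q * node q x k i / x s)⁻¹) * ∏ r, (1 - x r / (q * node q x k i)) =
      (-1) ^ n * (∏ r, x r) / (q * node q x k i) ^ n := by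
    rw [← Finset.prod_mul_distrib]
    have : ∀ s, (1 - q * node q x k i / x s)⁻¹ * (1 - x s / (q * node q x k i)) =
        -1 * x s / (q * node q x k i) := by
      intro s
      have h2 := hx s
      have h3 : x s - q * node q x k i ≠ 0 := sub_ne_zero.2 (hsx s)
      rw [one_sub_div h2, one_sub_div (mul_ne_zero hq hy0), inv_div, ← neg_sub (x s)]
      field_simp
    simp only [this, Finset.prod_div_distrib, Finset.prod_mul_distrib, Finset.prod_const,
      Finset.card_univ, Fintype.card_fin, mul_pow]
  -- `N` below is n - 1, kept in this form to avoid natural subtraction.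
  have hcard : (Finset.univ.erase i : Finset (Fin n)).card + 1 = n := by
    rw [Finset.card_erase_add_one (Finset.mem_univ i), Finset.card_univ, Fintype.card_fin]
  set N := (Finset.univ.erase i : Finset (Fin n)).card with hN
  have h2 : (∏ j ∈ Finset.univ.erase i,
        (q * node q x k i - node q x k j) / (node q x k i - node q x k j)) *
      ∏ j ∈ Finset.univ.erase i, (1 - α * q ^ (weight k + 1) * node q x k j) /
        (1 - node q x k j / (q * node q x k i)) =
      q ^ N * ∏ j ∈ Finset.univ.erase i,
        (1 - α * q ^ (weight k + 1) * node q x k j) / (1 - node q x k j / node q x k i) := by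
    rw [hN, ← Finset.prod_const, ← Finset.prod_mul_distrib, ← Finset.prod_mul_distrib]
    refine Finset.prod_congr rfl fun j hj => ?_
    have hji := Finset.ne_of_mem_erase hj
    have h3 : node q x k i - node q x k j ≠ 0 := sub_ne_zero.2 fun e => hji (hinj e).symm
    have h4 : q * node q x k i - node q x k j ≠ 0 := by
      have := (node_injective hq hgen (k + Pi.single i 1)).ne hji.symm
      rw [node_add_single_self, node_add_single_of_ne q x k hji] at this
      exact sub_ne_zero.2 this
    rw [one_sub_div hy0, one_sub_div (mul_ne_zero hq hy0)]
    field_simp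
  have h3 : ∏ j ∈ Finset.univ.erase i,
        (1 - α * q ^ (weight k + 1) * node q x (k + Pi.single i 1) j) /
          (1 - node q x (k + Pi.single i 1) j / (q * node q x k i)) =
      ∏ j ∈ Finset.univ.erase i, (1 - α * q ^ (weight k + 1) * node q x k j) /
        (1 - node q x k j / (q * node q x k i)) :=
    Finset.prod_congr rfl fun j hj => by
      rw [node_add_single_of_ne q x k (Finset.ne_of_mem_erase hj)]
  rw [nodePart, basePart, coef_add_single hq hx hgen, weight_add_single, node_add_single_self, h3]
  calc _ = coef q x k * (∏ r, qPoch q (α * x r) (weight k + 1)) *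
        (((∏ s, (1 - q * node q x k i / x s)⁻¹) * ∏ r, (1 - x r / (q * node q x k i))) *
        ((∏ j ∈ Finset.univ.erase i,
        (q * node q x k i - node q x k j) / (node q x k i - node q x k j)) *
      ∏ j ∈ Finset.univ.erase i, (1 - α * q ^ (weight k + 1) * node q x k j) /
        (1 - node q x k j / (q * node q x k i)))) *
        ((node q x k i ^ (n + 1) / ∏ r, x r) * (-1) ^ n * q ^ (weight k + 1) *
          α ^ (weight k + 1) * -(q ^ (weight k + 1))) := by ring
    _ = _ := by
      rw [h1, h2]
      -- One sign comes from the shift of `coef`, the other from `h1`.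
      have hs : ((-1 : ℂ) ^ n) * (-1) ^ n = 1 := by rw [← mul_pow]; simp
      generalize (∏ j ∈ Finset.univ.erase i, (1 - α * q ^ (weight k + 1) * node q x k j) /
        (1 - node q x k j / node q x k i)) = Z
      generalize (∏ r, qPoch q (α * x r) (weight k + 1)) = Y
      generalize node q x k i = y at *
      generalize ∏ r, x r = X at *
      have hqn : q ^ n = q ^ N * q := by rw [← hcard, pow_succ]
      rw [mul_pow q y, hqn, mul_pow α q]
      have hqN : q ^ N ≠ 0 := pow_ne_zero _ hq
      have hyn : y ^ n ≠ 0 := pow_ne_zero _ hy0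
      rw [pow_succ y, pow_succ q, pow_succ α]
      field_simp
      linear_combination (-(coef q x k * Y * Z * α * α ^ weight k)) * hs

/-- The Lagrange terms sum to ∏(1 - B y_i) - 1 with B = α q^(|k|+1), and (α x_r)_(|k|+1) = (1 - α
x_r)(αq x_r)_|k|. -/
theorem basePart_add_sum_nodePart {q : ℂ} (hq : q ≠ 0) {x : Fin n → ℂ} (hx : ∀ r, x r ≠ 0)
    (hgen : ∀ r s (m : ℕ), r ≠ s → x s ≠ x r * q ^ m)
    (hgen' : ∀ r s (m : ℕ), x s ≠ x r * q ^ (m + 1)) (α : ℂ) (k : Fin n → ℕ) :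
    basePart q x α k + ∑ i, nodePart q x α i (k + Pi.single i 1) =
      (∏ r, (1 - α * x r)) * term q x (α * q) k := by
  have h := prod_sub_one_eq_sum (node_injective hq hgen k) (node_ne_zero hq hx k)
    (α * q ^ (weight k + 1))
  simp only [nodePart_add_single hq hx hgen hgen']
  have hp : ∀ r, qPoch q (α * x r) (weight k + 1) =
      (1 - α * x r) * qPoch q (α * q * x r) (weight k) := by
    intro r
    simp only [qPoch, Finset.prod_range_succ']
    rw [mul_comm, pow_zero, mul_one]
    congr 1
    exact Finset.prod_congr rfl fun j _ => by ring
  rw [← Finset.mul_sum, ← h, term_eq hq hx hgen, basePart]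
  simp only [hp, Finset.prod_mul_distrib, pow_succ', ← mul_assoc]
  ring

end AnSylvester

end

noncomputable section

namespace AnSylvester

variable {n : ℕ}

/-! ### Exponentially bounded families -/

/-- Families of functions of the multi-index `k` which are bounded by `C * D ^ |k|`,
uniformly in a parameter. -/
def ExpBdd {ι : Type*} (f : ι → (Fin n → ℕ) → ℂ) : Prop :=
  ∃ C D : ℝ, 0 ≤ C ∧ 1 ≤ D ∧ ∀ i k, ‖f i k‖ ≤ C * D ^ weight k

namespace ExpBdd

variable {ι : Type*} {f g : ι → (Fin n → ℕ) → ℂ}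

theorem of_bounded {C : ℝ} (h : ∀ i k, ‖f i k‖ ≤ C) : ExpBdd f :=
  ⟨max C 0, 1, le_max_right _ _, le_rfl, fun i k => by
    simpa using Or.inl (h i k)⟩

theorem of_pow {C D : ℝ} (hC : 0 ≤ C) (hD : 1 ≤ D) (m : (Fin n → ℕ) → ℕ)
    (hm : ∀ k, m k ≤ weight k) (h : ∀ i k, ‖f i k‖ ≤ C * D ^ m k) : ExpBdd f :=
  ⟨C, D, hC, hD, fun i k => (h i k).trans
    (mul_le_mul_of_nonneg_left (pow_le_pow_right₀ hD (hm k)) hC)⟩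

theorem mul (hf : ExpBdd f) (hg : ExpBdd g) : ExpBdd fun i k => f i k * g i k := by
  obtain ⟨C, D, hC, hD, h⟩ := hf
  obtain ⟨C', D', hC', hD', h'⟩ := hg
  refine ⟨C * C', D * D', mul_nonneg hC hC', one_le_mul_of_one_le_of_one_le hD hD',
    fun i k => ?_⟩
  rw [norm_mul, mul_pow, mul_mul_mul_comm]
  exact mul_le_mul (h i k) (h' i k) (norm_nonneg _) (by positivity)

theorem prod {κ : Type*} (s : Finset κ) {f : κ → ι → (Fin n → ℕ) → ℂ}
    (h : ∀ a ∈ s, ExpBdd (f a)) : ExpBdd fun i k => ∏ a ∈ s, f a i k := by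
  classical
  induction s using Finset.induction_on with
  | empty => exact of_bounded (C := 1) fun i k => by simp
  | insert a s ha ih =>
    simp only [Finset.prod_insert ha]
    exact (h a (Finset.mem_insert_self a s)).mul
      (ih fun b hb => h b (Finset.mem_insert_of_mem hb))

theorem pow {c : ι → ℂ} {R : ℝ} (hc : ∀ i, ‖c i‖ ≤ R) (m : (Fin n → ℕ) → ℕ)
    (hm : ∀ k, m k ≤ weight k) : ExpBdd fun i k => c i ^ m k :=
  of_pow zero_le_one (le_max_right R 1) m hm fun i k => by
    rw [norm_pow, one_mul]
    exact pow_le_pow_left₀ (norm_nonneg _) ((hc i).trans (le_max_left _ _)) _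

theorem congr (hf : ExpBdd f) (h : ∀ i k, g i k = f i k) : ExpBdd g := by
  obtain ⟨C, D, hC, hD, hb⟩ := hf
  exact ⟨C, D, hC, hD, fun i k => by rw [h]; exact hb i k⟩

end ExpBdd

theorem le_weight (k : Fin n → ℕ) (r : Fin n) : k r ≤ weight k :=
  Finset.single_le_sum (f := k) (fun _ _ => Nat.zero_le _) (Finset.mem_univ r)

theorem summable_pi_prod {f : ℕ → ℝ} (hf0 : ∀ m, 0 ≤ f m) (hf : Summable f) :
    ∀ n : ℕ, Summable fun k : Fin n → ℕ => ∏ r, f (k r)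
  | 0 => Summable.of_finite
  | n + 1 => by
    have h := hf.mul_of_nonneg (summable_pi_prod hf0 hf n) hf0
      (fun k => Finset.prod_nonneg fun r _ => hf0 (k r))
    rw [← (Fin.consEquiv fun _ : Fin (n + 1) => ℕ).summable_iff]
    refine h.congr fun p => ?_
    simp [Fin.consEquiv, Fin.prod_univ_succ]

theorem summable_pow_mul_pow_choose (D : ℝ) {ρ : ℝ} (h0 : 0 < ρ) (h1 : ρ < 1) :
    Summable fun m : ℕ => D ^ m * ρ ^ m.choose 2 := by
  -- The ratio test needs nonzero terms; its ratio is |D| ρ^m, which tends to 0.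
  rcases eq_or_ne D 0 with rfl | hD
  · exact summable_of_ne_finset_zero (s := {0}) fun m hm => by
      rw [zero_pow (by simpa using hm), zero_mul]
  refine summable_of_ratio_test_tendsto_lt_one (l := 0) zero_lt_one
    (Filter.Eventually.of_forall fun m => by positivity) ?_
  have : (fun m : ℕ => ‖D ^ (m + 1) * ρ ^ (m + 1).choose 2‖ / ‖D ^ m * ρ ^ m.choose 2‖) =
      fun m => |D| * ρ ^ m := by
    funext m
    have h : D ^ (m + 1) * ρ ^ (m + 1).choose 2 / (D ^ m * ρ ^ m.choose 2) = D * ρ ^ m := by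
      rw [show (m + 1).choose 2 = m + m.choose 2 by
        rw [Nat.choose_succ_succ' m 1, Nat.choose_one_right], pow_add, pow_succ]
      field_simp
      ring
    rw [← norm_div, h, norm_mul, Real.norm_eq_abs, Real.norm_of_nonneg (by positivity)]
  rw [this]
  simpa using (tendsto_pow_atTop_nhds_zero_of_lt_one h0.le h1).const_mul |D|

/-- An exponentially bounded family times a Gaussian has a summable majorant. -/
theorem ExpBdd.exists_summable_bound {ι : Type*} {E : ι → (Fin n → ℕ) → ℂ} (hE : ExpBdd E)
    {q : ℂ} (hq0 : 0 < ‖q‖) (hq1 : ‖q‖ < 1) :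
    ∃ b : (Fin n → ℕ) → ℝ, Summable b ∧
      ∀ i k, ‖E i k * q ^ ∑ r, (k r).choose 2‖ ≤ b k := by
  obtain ⟨C, D, hC, hD, h⟩ := hE
  refine ⟨fun k => C * ∏ r, (D ^ k r * ‖q‖ ^ (k r).choose 2),
    (summable_pi_prod (fun m => by positivity)
      (summable_pow_mul_pow_choose D hq0 hq1) n).mul_left C, fun i k => ?_⟩
  beta_reduce
  rw [norm_mul, norm_pow, Finset.prod_mul_distrib, Finset.prod_pow_eq_pow_sum,
    Finset.prod_pow_eq_pow_sum, ← mul_assoc]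
  exact mul_le_mul_of_nonneg_right (h i k) (by positivity)

/-! ### Bounds for the factors of the summand and summability -/

theorem exists_bound_inv_one_sub {q : ℂ} (hq1 : ‖q‖ < 1) (z : ℂ) :
    ∃ C : ℝ, 1 ≤ C ∧ ∀ m : ℕ, ‖(1 - z * q ^ m)⁻¹‖ ≤ C := by
  -- A convergent sequence is bounded; a vanishing denominator contributes the value 0.
  have h : Filter.Tendsto (fun m : ℕ => (1 - z * q ^ m)⁻¹) Filter.atTop (nhds 1) := by
    have h1 := ((tendsto_pow_atTop_nhds_zero_of_norm_lt_one hq1).const_mul z).const_sub 1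
    rw [mul_zero, sub_zero] at h1
    simpa using h1.inv₀ one_ne_zero
  obtain ⟨C, hC⟩ := (Metric.isBounded_range_of_tendsto _ h).exists_norm_le
  exact ⟨max C 1, le_max_right _ _, fun m => (hC _ ⟨m, rfl⟩).trans (le_max_left _ _)⟩

theorem exists_bound_inv_qPoch {q : ℂ} (hq1 : ‖q‖ < 1) (z : ℂ) :
    ∃ C : ℝ, 1 ≤ C ∧ ∀ k, ‖(qPoch q z k)⁻¹‖ ≤ C ^ k := by
  obtain ⟨C, hC1, hC⟩ := exists_bound_inv_one_sub hq1 z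
  refine ⟨C, hC1, fun k => ?_⟩
  rw [qPoch, ← Finset.prod_inv_distrib, norm_prod]
  exact (Finset.prod_le_prod (fun _ _ => norm_nonneg _) (g := fun _ => C)
    fun i _ => hC i).trans (by simp)

theorem norm_qPoch_le {q : ℂ} (hq1 : ‖q‖ < 1) {z : ℂ} {R : ℝ} (hz : ‖z‖ ≤ R) (k : ℕ) :
    ‖qPoch q z k‖ ≤ (1 + R) ^ k := by
  rw [qPoch, norm_prod]
  refine (Finset.prod_le_prod (fun _ _ => norm_nonneg _) (g := fun _ => 1 + R)
    fun i _ => ?_).trans (by simp)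
  refine (norm_sub_le _ _).trans ?_
  rw [norm_one, norm_mul, norm_pow]
  have := mul_le_mul hz (pow_le_one₀ (norm_nonneg q) hq1.le (n := i)) (by positivity)
    ((norm_nonneg z).trans hz)
  linarith

theorem norm_node_le {q : ℂ} (hq1 : ‖q‖ < 1) (x : Fin n → ℂ) (k : Fin n → ℕ) (r : Fin n) :
    ‖node q x k r‖ ≤ ‖x r‖ := by
  rw [node, norm_mul, norm_pow]
  exact mul_le_of_le_one_right (norm_nonneg _) (pow_le_one₀ (norm_nonneg _) hq1.le)

/-- The quotient of `coef` by its Gaussian factor. -/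
def coefExp (q : ℂ) (x : Fin n → ℂ) (k : Fin n → ℕ) : ℂ :=
  (∏ r, ∏ s ∈ Finset.Ioi r, (node q x k s - node q x k r) / (x s - x r))
    * (∏ r, ∏ s, (qPoch q (q * x r / x s) (k r))⁻¹)
    * (∏ r, x r ^ (((n : ℤ) + 1) * (k r : ℤ) - (weight k : ℤ)))
    * (-1) ^ (n * weight k)
    * q ^ (n * (∑ r, (k r).choose 2) + (weight k).choose 2 + weight k)

theorem coef_eq_coefExp_mul (q : ℂ) (x : Fin n → ℂ) (k : Fin n → ℕ) :
    coef q x k = coefExp q x k * q ^ ∑ r, (k r).choose 2 := by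
  rw [coef, coefExp, mul_assoc _ (q ^ _) (q ^ _), ← pow_add]
  congr 2
  ring

theorem expBdd_coefExp (ι : Type*) {q : ℂ} (hq1 : ‖q‖ < 1) {x : Fin n → ℂ}
    (hx : ∀ r, x r ≠ 0) :
    ExpBdd fun (_ : ι) k => coefExp q x k := by
  unfold coefExp
  refine ((((ExpBdd.prod _ fun r _ => ExpBdd.prod _ fun s _ => ?_).mul
    (ExpBdd.prod _ fun r _ => ExpBdd.prod _ fun s _ => ?_)).mul
    (ExpBdd.prod _ fun r _ => ?_)).mul ?_).mul ?_
  · refine ExpBdd.of_bounded (C := (‖x s‖ + ‖x r‖) / ‖x s - x r‖) fun _ k => ?_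
    rw [norm_div]
    gcongr
    exact (norm_sub_le _ _).trans (add_le_add (norm_node_le hq1 x k s) (norm_node_le hq1 x k r))
  · obtain ⟨C, hC1, hC⟩ := exists_bound_inv_qPoch hq1 (q * x r / x s)
    exact ExpBdd.of_pow zero_le_one hC1 (fun k => k r) (fun k => le_weight k r)
      fun _ k => by simpa using hC (k r)
  · refine ((ExpBdd.pow (c := fun _ => x r ^ (n + 1)) (fun _ => le_rfl) (fun k => k r)
      (fun k => le_weight k r)).mul (ExpBdd.pow (c := fun _ => (x r)⁻¹) (fun _ => le_rfl)
      weight (fun k => le_rfl))).congr fun _ k => ?_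
    rw [zpow_sub₀ (hx r), zpow_natCast, inv_pow, ← div_eq_mul_inv, ← pow_mul, ← zpow_natCast (x r)]
    rfl
  · exact ExpBdd.of_bounded (C := 1) fun _ k => by simp
  · exact ExpBdd.of_bounded (C := 1) fun _ k => by
      rw [norm_pow]; exact pow_le_one₀ (norm_nonneg _) hq1.le

theorem expBdd_one_sub_mul_node {ι : Type*} {q : ℂ} (hq1 : ‖q‖ < 1) (x : Fin n → ℂ)
    {c : ι → ℂ} {R : ℝ} (hc : ∀ i, ‖c i‖ ≤ R) (m : (Fin n → ℕ) → ℕ) (r : Fin n) :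
    ExpBdd fun i k => 1 - c i * q ^ m k * node q x k r := by
  refine ExpBdd.of_bounded (C := 1 + R * 1 * ‖x r‖) fun i k => (norm_sub_le _ _).trans ?_
  rw [norm_one, norm_mul, norm_mul, norm_pow]
  have hR := (norm_nonneg _).trans (hc i)
  gcongr
  · exact hc i
  · exact pow_le_one₀ (norm_nonneg _) hq1.le
  · exact norm_node_le hq1 x k r

theorem expBdd_qPoch {ι : Type*} {q : ℂ} (hq1 : ‖q‖ < 1) {c : ι → ℂ} {R : ℝ}
    (hc : ∀ i, ‖c i‖ ≤ R) (hR : 0 ≤ R) (a : ℕ) :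
    ExpBdd fun i (k : Fin n → ℕ) => qPoch q (c i) (weight k + a) :=
  ExpBdd.of_pow (C := (1 + R) ^ a) (D := 1 + R) (by positivity) (by linarith) weight
    (fun _ => le_rfl) fun i k => by
      rw [← pow_add, add_comm a]; exact norm_qPoch_le hq1 (hc i) _

/-- Uniform summable majorant of the summands for bounded `α`. -/
theorem exists_summable_bound_term {q : ℂ} (hq0 : 0 < ‖q‖) (hq1 : ‖q‖ < 1) {x : Fin n → ℂ}
    (hx : ∀ r, x r ≠ 0)
    (hgen : ∀ r s (m : ℕ), r ≠ s → x s ≠ x r * q ^ m)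
    {ι : Type*} {α : ι → ℂ} {R : ℝ} (hR : 0 ≤ R) (hα : ∀ i, ‖α i‖ ≤ R) :
    ∃ b : (Fin n → ℕ) → ℝ, Summable b ∧ ∀ i k, ‖term q x (α i) k‖ ≤ b k := by
  have hE := (((expBdd_coefExp ι hq1 hx).mul
    (ExpBdd.prod Finset.univ fun r _ => expBdd_one_sub_mul_node hq1 x hα weight r)).mul
    (ExpBdd.prod Finset.univ fun r _ => expBdd_qPoch hq1 (c := fun i => α i * x r)
      (R := R * ‖x r‖) (fun i => by rw [norm_mul]; gcongr; exact hα i) (by positivity) 0)).mul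
    (ExpBdd.pow hα weight fun _ => le_rfl)
  obtain ⟨b, hb, h⟩ := hE.exists_summable_bound hq0 hq1
  refine ⟨b, hb, fun i k => le_trans (le_of_eq ?_) (h i k)⟩
  rw [term_eq (norm_pos_iff.1 hq0) hx hgen, coef_eq_coefExp_mul]
  congr 1
  simp only [add_zero]
  ring

theorem summable_term {q : ℂ} (hq0 : 0 < ‖q‖) (hq1 : ‖q‖ < 1) {x : Fin n → ℂ}
    (hx : ∀ r, x r ≠ 0)
    (hgen : ∀ r s (m : ℕ), r ≠ s → x s ≠ x r * q ^ m) (α : ℂ) :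
    Summable fun k => term q x α k := by
  obtain ⟨b, hb, h⟩ := exists_summable_bound_term hq0 hq1 hx hgen (ι := Unit)
    (α := fun _ => α) (norm_nonneg α) (fun _ => le_rfl)
  exact hb.of_norm_bounded (h ())

theorem expBdd_basePart {q : ℂ} (hq1 : ‖q‖ < 1) {x : Fin n → ℂ}
    (hx : ∀ r, x r ≠ 0) (α : ℂ) :
    ExpBdd fun (_ : Unit) (k : Fin n → ℕ) =>
      coefExp q x k * (∏ r, qPoch q (α * x r) (weight k + 1)) * (α * q) ^ weight k :=
  ((expBdd_coefExp Unit hq1 hx).mul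
    (ExpBdd.prod Finset.univ fun r _ => expBdd_qPoch hq1 (c := fun _ => α * x r)
      (fun _ => le_rfl) (norm_nonneg _) 1)).mul
    (ExpBdd.pow (c := fun _ => α * q) (fun _ => le_rfl) weight fun _ => le_rfl)

theorem summable_basePart {q : ℂ} (hq0 : 0 < ‖q‖) (hq1 : ‖q‖ < 1) {x : Fin n → ℂ}
    (hx : ∀ r, x r ≠ 0) (α : ℂ) :
    Summable fun k => basePart q x α k := by
  obtain ⟨b, hb, h⟩ := (expBdd_basePart hq1 hx α).exists_summable_bound hq0 hq1
  refine hb.of_norm_bounded fun k => le_trans (le_of_eq ?_) (h () k)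
  rw [basePart, coef_eq_coefExp_mul]
  congr 1
  ring

/-- The quotient of nodes depends only on k_j - k_i. When this is negative, the reciprocal t of the
quotient is used through 1 / (1 - 1/t) = -t / (1 - t), which stays bounded. -/
theorem exists_bound_inv_one_sub_node_div {q : ℂ} (hq : q ≠ 0) (hq1 : ‖q‖ < 1) {x : Fin n → ℂ}
    (hx : ∀ r, x r ≠ 0) (i j : Fin n) :
    ∃ C : ℝ, ∀ k, ‖(1 - node q x k j / node q x k i)⁻¹‖ ≤ C := by
  obtain ⟨C, hC1, hC⟩ := exists_bound_inv_one_sub hq1 (x j / x i)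
  obtain ⟨C', hC1', hC'⟩ := exists_bound_inv_one_sub hq1 (x i / x j)
  refine ⟨max C (‖x i / x j‖ * C'), fun k => ?_⟩
  have hi := hx i
  have hj := hx j
  rcases le_total (k i) (k j) with h | h
  · obtain ⟨m, hm⟩ := Nat.exists_eq_add_of_le h
    have : node q x k j / node q x k i = x j / x i * q ^ m := by
      simp only [node, hm, pow_add]
      field_simp
    rw [this]
    exact (hC m).trans (le_max_left _ _)
  · obtain ⟨m, hm⟩ := Nat.exists_eq_add_of_le h
    have : (1 - node q x k j / node q x k i)⁻¹ =
        -(x i / x j) * q ^ m * (1 - x i / x j * q ^ m)⁻¹ := by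
      have h1 : node q x k j / node q x k i = (x i / x j * q ^ m)⁻¹ := by
        simp only [node, hm, pow_add]
        field_simp
      have h2 : x i / x j * q ^ m ≠ 0 := mul_ne_zero (div_ne_zero hi hj) (pow_ne_zero _ hq)
      rw [h1, neg_mul]
      generalize x i / x j * q ^ m = t at *
      have h3 : 1 - t⁻¹ = -(1 - t) / t := by field_simp; ring
      rw [h3, inv_div, div_neg, neg_mul, div_eq_mul_inv]
    rw [this, norm_mul, norm_mul, norm_neg, norm_pow]
    refine le_trans ?_ (le_max_right _ _)
    refine mul_le_mul ?_ (hC' m) (norm_nonneg _) (norm_nonneg _)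
    exact mul_le_of_le_one_right (norm_nonneg _) (pow_le_one₀ (norm_nonneg _) hq1.le)

theorem summable_nodePart_add_single {q : ℂ} (hq0 : 0 < ‖q‖) (hq1 : ‖q‖ < 1) {x : Fin n → ℂ}
    (hx : ∀ r, x r ≠ 0)
    (hgen : ∀ r s (m : ℕ), r ≠ s → x s ≠ x r * q ^ m)
    (hgen' : ∀ r s (m : ℕ), x s ≠ x r * q ^ (m + 1)) (α : ℂ) (i : Fin n) :
    Summable fun k : Fin n → ℕ => nodePart q x α i (k + Pi.single i 1) := by
  have hq := norm_pos_iff.1 hq0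
  have h1 : ExpBdd fun (_ : Unit) (k : Fin n → ℕ) => -(α * q ^ (weight k + 1) * node q x k i) := by
    refine ExpBdd.of_bounded (C := ‖α‖ * 1 * ‖x i‖) fun _ k => ?_
    rw [norm_neg, norm_mul, norm_mul, norm_pow]
    gcongr
    · exact pow_le_one₀ (norm_nonneg _) hq1.le
    · exact norm_node_le hq1 x k i
  have h2 : ExpBdd fun (_ : Unit) (k : Fin n → ℕ) => ∏ j ∈ Finset.univ.erase i,
      ((1 - α * q ^ (weight k + 1) * node q x k j) *
        (1 - node q x k j / node q x k i)⁻¹) := by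
    refine ExpBdd.prod (f := fun j (_ : Unit) k => (1 - α * q ^ (weight k + 1) * node q x k j) *
      (1 - node q x k j / node q x k i)⁻¹) _ fun j _ => ?_
    obtain ⟨C, hC⟩ := exists_bound_inv_one_sub_node_div hq hq1 hx i j
    exact (expBdd_one_sub_mul_node hq1 x (c := fun _ => α) (fun _ => le_rfl)
      (fun k => weight k + 1) j).mul (ExpBdd.of_bounded fun _ k => hC k)
  obtain ⟨b, hb, h⟩ := ((expBdd_basePart hq1 hx α).mul
    (h1.mul h2)).exists_summable_bound hq0 hq1
  refine hb.of_norm_bounded fun k => le_trans (le_of_eq ?_) (h () k)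
  rw [nodePart_add_single hq hx hgen hgen', basePart, coef_eq_coefExp_mul]
  simp only [div_eq_mul_inv]
  congr 1
  ring

/-! ### Functional equation, iteration and limit -/

/-- The functional equation of the series under `α ↦ α q`. -/
theorem tsum_term_eq_mul {q : ℂ} (hq0 : 0 < ‖q‖) (hq1 : ‖q‖ < 1) {x : Fin n → ℂ}
    (hx : ∀ r, x r ≠ 0)
    (hgen : ∀ r s (m : ℕ), r ≠ s → x s ≠ x r * q ^ m)
    (hgen' : ∀ r s (m : ℕ), x s ≠ x r * q ^ (m + 1)) (α : ℂ) :
    ∑' k, term q x α k = (∏ r, (1 - α * x r)) * ∑' k, term q x (α * q) k := by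
  have hq := norm_pos_iff.1 hq0
  have hbase := summable_basePart hq0 hq1 hx α
  have hshift := summable_nodePart_add_single hq0 hq1 hx hgen hgen' α
  have hinj : ∀ i : Fin n, Function.Injective fun k : Fin n → ℕ => k + Pi.single i 1 :=
    fun i => add_left_injective _
  have hzero : ∀ i, ∀ k ∉ Set.range (fun k : Fin n → ℕ => k + Pi.single i 1),
      nodePart q x α i k = 0 := by
    intro i k hk
    refine nodePart_eq_zero hx α i k (by_contra fun h => hk ⟨k - Pi.single i 1, ?_⟩)
    refine tsub_add_cancel_of_le fun r => ?_
    by_cases hr : r = i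
    · subst hr; simpa using Nat.one_le_iff_ne_zero.2 h
    · simp [Pi.single_eq_of_ne hr]
  -- The support of `nodePart` lies in the range of the injective shift, so summability and sum
  -- transfer from the shifted family.
  have hnode : ∀ i, Summable (nodePart q x α i) := fun i =>
    ((hinj i).summable_iff (hzero i)).1 (hshift i)
  have heq : ∀ i, ∑' k, nodePart q x α i k = ∑' k, nodePart q x α i (k + Pi.single i 1) :=
    fun i => ((hinj i).tsum_eq fun k hk => by_contra fun h => hk (hzero i k h)).symm
  simp only [term_eq_add_sum hq hx hgen α]
  rw [← tsum_mul_left]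
  simp only [← basePart_add_sum_nodePart hq hx hgen hgen' α]
  rw [hbase.tsum_add (summable_sum fun i _ => hnode i),
    hbase.tsum_add (summable_sum fun i _ => hshift i),
    Summable.tsum_finsetSum fun i _ => hnode i, Summable.tsum_finsetSum fun i _ => hshift i]
  simp only [heq]

/-- The factor α^|k| kills every multi-index but 0, which gives F(0) = 1. -/
theorem term_zero_right (q : ℂ) {x : Fin n → ℂ} (hdiff : ∀ r s, r < s → 1 - x r / x s ≠ 0)
    (k : Fin n → ℕ) : term q x 0 k = if k = 0 then 1 else 0 := by
  split_ifs with hk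
  · subst hk
    have : ∏ r, ∏ s ∈ Finset.Ioi r, (1 - x r / x s) / (1 - x r / x s) = 1 :=
      Finset.prod_eq_one fun r _ => Finset.prod_eq_one fun s hs =>
        div_self (hdiff r s (Finset.mem_Ioi.1 hs))
    simp only [term, weight, qPoch]
    simp [-Finset.prod_div_distrib, this]
  · have hw : weight k ≠ 0 := fun h => hk (funext fun r => by
      simpa [h] using le_weight k r)
    simp [term, hw]

theorem continuous_term (q : ℂ) (x : Fin n → ℂ) (k : Fin n → ℕ) :
    Continuous fun α => term q x α k := by
  unfold term qPoch
  fun_prop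

/-- The `A_n` Sylvester identity, without a nonvanishing condition on `α`. -/
theorem tsum_term {q : ℂ} (hq0 : 0 < ‖q‖) (hq1 : ‖q‖ < 1) {x : Fin n → ℂ}
    (hx : ∀ r, x r ≠ 0) (hdiff : ∀ r s, r < s → 1 - x r / x s ≠ 0)
    (hgen : ∀ r s (m : ℕ), r ≠ s → x s ≠ x r * q ^ m)
    (hgen' : ∀ r s (m : ℕ), x s ≠ x r * q ^ (m + 1)) (α : ℂ) :
    ∑' k, term q x α k = ∏ r, qPochInf q (α * x r) := by
  have hiter : ∀ m : ℕ, ∑' k, term q x α k =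
      (∏ r, qPoch q (α * x r) m) * ∑' k, term q x (α * q ^ m) k := by
    intro m
    induction m with
    | zero => simp [qPoch]
    | succ m ih =>
      rw [ih, tsum_term_eq_mul hq0 hq1 hx hgen hgen', ← mul_assoc,
        ← Finset.prod_mul_distrib, mul_assoc α, ← pow_succ]
      congr 1
      refine Finset.prod_congr rfl fun r _ => ?_
      rw [qPoch_succ, mul_right_comm α]
  have hprod : Filter.Tendsto (fun m => ∏ r, qPoch q (α * x r) m) Filter.atTop
      (nhds (∏ r, qPochInf q (α * x r))) :=
    tendsto_finsetProd _ fun r _ =>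
      (multipliable_qPochInf hq1 (α * x r)).hasProd.tendsto_prod_nat
  -- All α q^m lie in the disc of radius |α|, so one majorant serves every m.
  obtain ⟨b, hb, hle⟩ := exists_summable_bound_term hq0 hq1 hx hgen
    (α := fun m : ℕ => α * q ^ m) (norm_nonneg α) fun m => by
      rw [norm_mul, norm_pow]
      exact mul_le_of_le_one_right (norm_nonneg _) (pow_le_one₀ (norm_nonneg _) hq1.le)
  have hlim : Filter.Tendsto (fun m : ℕ => ∑' k, term q x (α * q ^ m) k) Filter.atTop
      (nhds (∑' k, term q x 0 k)) := by
    refine tendsto_tsum_of_dominated_convergence hb (fun k => ?_)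
      (Filter.Eventually.of_forall hle)
    have h0 := (tendsto_pow_atTop_nhds_zero_of_norm_lt_one hq1).const_mul α
    rw [mul_zero] at h0
    exact ((continuous_term q x k).tendsto 0).comp h0
  have hF0 : ∑' k, term q x 0 k = 1 := by
    simp only [term_zero_right q hdiff]
    exact tsum_ite_eq 0 _
  have h := hprod.mul hlim
  rw [hF0, mul_one] at h
  refine tendsto_nhds_unique (tendsto_const_nhds.congr hiter) h

end AnSylvester

end

/-! ### The Sylvester and pentagonal identities -/

theorem mainTheorem7 (n : ℕ) (q : ℂ) (hq0 : 0 < ‖q‖) (hq1 : ‖q‖ < 1)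
    (x : Fin n → ℂ)
    (hx : ∀ r, x r ≠ 0)
    (hdiff : ∀ r s, r < s → 1 - x r / x s ≠ 0)
    (hden : ∀ (r s : Fin n) (k : ℕ), AnSylvester.qPoch q (q * x r / x s) k ≠ 0) :
    (∀ α : ℂ, (∀ r, AnSylvester.qPochInf q (α * x r) ≠ 0) →
      Summable (fun k : Fin n → ℕ => AnSylvester.term q x α k) ∧
      1 = (∏ r, AnSylvester.qPochInf q (α * x r))⁻¹
            * ∑' k : Fin n → ℕ, AnSylvester.term q x α k) ∧
    ((∀ r, 1 - x r ≠ 0) →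
      Summable (fun k : Fin n → ℕ => AnSylvester.term q x 1 k) ∧
      ∏ r, AnSylvester.qPochInf q (q * x r) =
        (∏ r, (1 - x r))⁻¹ * ∑' k : Fin n → ℕ, AnSylvester.term q x 1 k) := by
  have hgen' : ∀ r s (m : ℕ), x s ≠ x r * q ^ (m + 1) := by
    intro r s m h
    -- The last factor of (q x_r / x_s)_(m+1) is 1 - (x_r / x_s) q^(m+1), which would vanish.
    refine hden r s (m + 1) ?_
    have h1 : q * x r / x s * q ^ m = 1 := by
      rw [div_mul_eq_mul_div, div_eq_one_iff_eq (hx s), h]; ring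
    rw [AnSylvester.qPoch_succ, h1, sub_self, mul_zero]
  have hne : ∀ r s, r < s → x r ≠ x s := fun r s hrs h =>
    hdiff r s hrs (by rw [h, div_self (hx s), sub_self])
  have hgen : ∀ r s (m : ℕ), r ≠ s → x s ≠ x r * q ^ m := by
    intro r s m hrs
    cases m with
    | zero =>
      rw [pow_zero, mul_one]
      rcases lt_or_gt_of_ne hrs with h | h
      · exact (hne r s h).symm
      · exact hne s r h
    | succ m => exact hgen' r s m
  have hsum := AnSylvester.summable_term hq0 hq1 hx hgen
  have htsum := AnSylvester.tsum_term hq0 hq1 hx hdiff hgen hgen'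
  refine ⟨fun α hα => ⟨hsum α, ?_⟩, fun h1 => ⟨hsum 1, ?_⟩⟩
  · rw [htsum, inv_mul_cancel₀ (Finset.prod_ne_zero_iff.2 fun r _ => hα r)]
  · rw [htsum, eq_inv_mul_iff_mul_eq₀ (Finset.prod_ne_zero_iff.2 fun r _ => h1 r),
      ← Finset.prod_mul_distrib]
    refine Finset.prod_congr rfl fun r _ => ?_
    -- Splitting off one factor: (x_r)_∞ = (1 - x_r)(q x_r)_∞.
    rw [one_mul, ← AnSylvester.qPoch_mul_qPochInf hq1 (x r) 1]
    simp [AnSylvester.qPoch, mul_comm]
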